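/- Let $n,q,K\ge 1$, $J\ge 0$, let $\sigma>0$ be known, let $\mu\in\mathbb R^{n\times q}$ have rows $\mu_1,\dots,\mu_n$, and let $X\in\mathbb R^{n\times q}$ be a random matrix with independent rows $X_i\sim\mathcal N(\mu_i,\sigma^2 I_q)$. For $A\in\mathbb R^{n\times q}$ let $\mathcal C(A)$ be the outcome of $K$-means clustering (Lloyd's algorithm with $J$ iterations) run on the rows of $A$, that is, the list of the cluster assignments $\{1,\dots,n\}\to\{1,\dots,K\}$ produced at the steps $0,1,\dots,J$: at step $0$ every row is assigned to a closest initial center, where the initial centers are a measurable function of $A$; at each later step every row is assigned to a closest center among the means of the current non-empty clusters; ties are resolved by a fixed rule that depends only on the set of closest labels. Write $\mathcal C_1,\dots,\mathcal C_K$ for the clusters of the last assignment in $\mathcal C(X)$. Let $\mathcal V(A)\subseteq\{(k,k'):1\le k<k'\le K\}$ be a measurable (data-dependent) selection of pairs, and $\mathcal V=\mathcal V(X)$. For non-empty $\mathcal C_k,\mathcal C_{k'}$ put $\mathbf v_{k,k'}=\frac1{|\mathcal C_k|}\mathbf 1_{\mathcal C_k}-\frac1{|\mathcal C_{k'}|}\mathbf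 1_{\mathcal C_{k'}}\in\mathbb R^n$; a cluster mean over an empty cluster, and the corresponding term of $\mathbf v_{k,k'}$, are read as $0$ (this matters only for outcomes about which nothing is claimed below). Let $\mathcal E=\mathrm{span}\{\mathbf v_{k,k'}:(k,k')\in\mathcal V\}$, let $P_{\mathcal E}$ be the orthogonal projection matrix onto $\mathcal E$, $P_{\mathcal E}^\perp=I_n-P_{\mathcal E}$, and $d=q\cdot\dim(\mathcal E)$. Define $$T_\sigma=\frac{\|P_{\mathcal E}X\|_F}{\sigma},\qquad Z=\Big(\frac{P_{\mathcal E}X}{\|P_{\mathcal E}X\|_F},\,P_{\mathcal E}^\perp X\Big),\qquad x_\sigma(\psi)=\psi\,\frac{\sigma P_{\mathcal E}X}{\|P_{\mathcal E}X\|_F}+P_{\mathcal E}^\perp X\quad(\psi\ge 0),$$ where $P_{\mathcal E}X/\|P_{\mathcal E}X\|_F$ is read as $0$ if $P_{\mathcal E}X=0$, and $$\mathcal S_\sigma=\{\psi\ge0:\mathcal C(X)=\mathcal C(x_\sigma(\psi))\},\qquad \mathcal S_{\sigma,\mathcal V}=\{\psi\ge0:\mathcal V(X)=\mathcal V(x_\sigma(\psi))\},\qquad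 \mathcal S_{\sigma,J}=\mathcal S_\sigma\cap\mathcal S_{\sigma,\mathcal V}.$$ Let $Q_{\sigma,J}$ be the conditional CDF of $T_\sigma$ given $(\mathcal C(X),\mathcal V(X),Z)$, and $p_{\sigma,J}=1-Q_{\sigma,J}(T_\sigma)$. Let $\chi_d$ be the law of $\sqrt Y$ with $Y\sim\chi^2_d$, and for $S\subseteq[0,\infty)$ with $\chi_d(S)>0$ let $F_{\chi_d}(t;S)=\chi_d((-\infty,t]\cap S)/\chi_d(S)$. Consider the outcomes $(c,v)$ of $(\mathcal C(X),\mathcal V(X))$ for which $v\ne\emptyset$, all clusters occurring in a pair of $v$ are non-empty, and the null hypothesis $H_{0,\mathcal V}$ holds: $$\frac1{|\mathcal C_k|}\sum_{i\in\mathcal C_k}\mu_i=\frac1{|\mathcal C_{k'}|}\sum_{i\in\mathcal C_{k'}}\mu_i\quad\text{for all }(k,k')\in v,$$ where $\mathcal C_1,\dots,\mathcal C_K$ are the clusters of the last assignment in $c$. 1. Almost surely, if $(\mathcal C(X),\mathcal V(X))$ is such an outcome, then $\chi_d(\mathcal S_{\sigma,J})>0$ and $Q_{\sigma,J}(t)=F_{\chi_d}(t;\mathcal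 S_{\sigma,J})$ for all $t\in\mathbb R$. 2. For each such outcome $(c,v)$ with $\mathbb P(\mathcal C(X)=c,\ \mathcal V(X)=v)>0$ and every $\alpha\in[0,1]$, $$\mathbb P\big(p_{\sigma,J}\le\alpha\,\big|\,\mathcal C(X)=c,\ \mathcal V(X)=v\big)=\alpha,$$ that is, $p_{\sigma,J}$ is exactly $\mathrm{Uniform}(0,1)$ conditionally on $\mathcal C(X)$ and $\mathcal V(X)$. -/

import Mathlib

open MeasureTheory ProbabilityTheory

noncomputable section

namespace KMeansTest

variable {n q K J : ℕ}

/-- An `n × q` data matrix, as the family of its rows in `ℝ^q` with the Euclidean norm. -/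
abbrev Data (n q : ℕ) : Type := Fin n → EuclideanSpace ℝ (Fin q)

/-- The cluster assignments of all steps `0, …, J` of the `K`-means algorithm. -/
abbrev History (n K J : ℕ) : Type := Fin (J + 1) → Fin n → Fin K

/-- The set of indices that the assignment `c` puts into the `k`-th cluster. -/
def cluster (c : Fin n → Fin K) (k : Fin K) : Finset (Fin n) :=
  Finset.univ.filter fun i => c i = k

/-- The average of the rows of `A` in the `k`-th cluster. -/
def clusterMean (A : Data n q) (c : Fin n → Fin K) (k : Fin K) : EuclideanSpace ℝ (Fin q) :=
  ((cluster c k).card : ℝ)⁻¹ • ∑ i ∈ cluster c k, A i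

open Classical in
/-- The labels in `L` whose center is closest to `x` among the centers with a label in `L`. -/
def nearest (x : EuclideanSpace ℝ (Fin q)) (L : Finset (Fin K))
    (m : Fin K → EuclideanSpace ℝ (Fin q)) : Finset (Fin K) :=
  L.filter fun l => ∀ l' ∈ L, ‖x - m l‖ ≤ ‖x - m l'‖

/-- The assignment after step `j` of Lloyd's algorithm run on the rows of `A`. The initial centers
are `init A`; at every later step the centers are the means of the current clusters (a cluster that
has become empty has no center). Ties between closest centers are resolved by `tie`. -/
def lloyd (tie : Finset (Fin K) → Fin K)
    (init : Data n q → Fin K → EuclideanSpace ℝ (Fin q)) (A : Data n q) : ℕ → Fin n → Fin K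
  | 0 => fun i => tie (nearest (A i) Finset.univ (init A))
  | j + 1 => fun i =>
      tie (nearest (A i)
        (Finset.univ.filter fun l => (cluster (lloyd tie init A j) l).Nonempty)
        (clusterMean A (lloyd tie init A j)))

/-- The outcome of `K`-means clustering with `J` iterations: the assignments of every step. -/
def kmeans (J : ℕ) (tie : Finset (Fin K) → Fin K)
    (init : Data n q → Fin K → EuclideanSpace ℝ (Fin q)) (A : Data n q) : History n K J :=
  fun j => lloyd tie init A j

/-- The final assignment, which defines the estimated clusters. -/
def finalAssign (h : History n K J) : Fin n → Fin K := h (Fin.last J)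

/-- The null hypothesis for the clusters of the assignment `c` and the set of pairs `v`. -/
def Null (μ : Data n q) (c : Fin n → Fin K) (v : Finset (Fin K × Fin K)) : Prop :=
  ∀ p ∈ v, clusterMean μ c p.1 = clusterMean μ c p.2

/-- At least one pair is selected, and every cluster that occurs in a selected pair is non-empty,
so that its mean is defined. -/
def Testable (c : Fin n → Fin K) (v : Finset (Fin K × Fin K)) : Prop :=
  v.Nonempty ∧ ∀ p ∈ v, (cluster c p.1).Nonempty ∧ (cluster c p.2).Nonempty

/-- `𝟏_{C_k} / |C_k| - 𝟏_{C_k'} / |C_k'|`. -/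
def contrast (c : Fin n → Fin K) (k k' : Fin K) : EuclideanSpace ℝ (Fin n) :=
  WithLp.toLp 2 fun i =>
    (if c i = k then ((cluster c k).card : ℝ)⁻¹ else 0) -
      (if c i = k' then ((cluster c k').card : ℝ)⁻¹ else 0)

/-- The span of the contrasts of the pairs in `v`. -/
def contrastSpan (c : Fin n → Fin K) (v : Finset (Fin K × Fin K)) :
    Submodule ℝ (EuclideanSpace ℝ (Fin n)) :=
  Submodule.span ℝ {w | ∃ p ∈ v, w = contrast c p.1 p.2}

/-- The matrix of the orthogonal projection onto `E`. -/
def projMatrix (E : Submodule ℝ (EuclideanSpace ℝ (Fin n))) : Matrix (Fin n) (Fin n) ℝ :=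
  Matrix.of fun i k => E.starProjection (EuclideanSpace.single k 1) i

/-- The matrix product `M A`, row by row. -/
def matMul (M : Matrix (Fin n) (Fin n) ℝ) (A : Data n q) : Data n q :=
  fun i => ∑ k, M i k • A k

/-- The Frobenius norm. -/
def frobNorm (A : Data n q) : ℝ := Real.sqrt (∑ i, ‖A i‖ ^ 2)

section Procedure

variable (C : Data n q → History n K J) (V : Data n q → Finset (Fin K × Fin K))

/-- The space `𝓔` determined by the clustering and the selection on the data `A`. -/
def testSpace (A : Data n q) : Submodule ℝ (EuclideanSpace ℝ (Fin n)) :=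
  contrastSpan (finalAssign (C A)) (V A)

/-- `P_𝓔 A`. -/
def projPart (A : Data n q) : Data n q := matMul (projMatrix (testSpace C V A)) A

/-- `(I - P_𝓔) A`. -/
def perpPart (A : Data n q) : Data n q := matMul (1 - projMatrix (testSpace C V A)) A

/-- The test statistic `‖P_𝓔 A‖_F / σ`. -/
def testStat (σ : ℝ) (A : Data n q) : ℝ := frobNorm (projPart C V A) / σ

/-- `P_𝓔 A / ‖P_𝓔 A‖_F`. -/
def direction (A : Data n q) : Data n q := (frobNorm (projPart C V A))⁻¹ • projPart C V A

/-- The curve `ψ ↦ ψ σ P_𝓔 A / ‖P_𝓔 A‖_F + (I - P_𝓔) A`. -/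
def curve (σ : ℝ) (A : Data n q) (ψ : ℝ) : Data n q :=
  ψ • (σ • direction C V A) + perpPart C V A

/-- The `ψ ≥ 0` at which the clustering outcome on the curve is the one on `A`. -/
def clusterSet (σ : ℝ) (A : Data n q) : Set ℝ := {ψ | 0 ≤ ψ ∧ C A = C (curve C V σ A ψ)}

/-- The `ψ ≥ 0` at which the selected set of pairs on the curve is the one on `A`. -/
def selectionSet (σ : ℝ) (A : Data n q) : Set ℝ := {ψ | 0 ≤ ψ ∧ V A = V (curve C V σ A ψ)}

/-- The truncation set. -/
def truncSet (σ : ℝ) (A : Data n q) : Set ℝ := clusterSet C V σ A ∩ selectionSet C V σ A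

/-- What is conditioned on: `𝒞(A)`, `𝒱(A)` and `Z = (P_𝓔 A / ‖P_𝓔 A‖_F, (I - P_𝓔) A)`. -/
def condVar (A : Data n q) :
    History n K J × Finset (Fin K × Fin K) × (Data n q × Data n q) :=
  (C A, V A, (direction C V A, perpPart C V A))

/-- The conditional CDF of the test statistic given `condVar`, at the outcome `ω`. -/
def condCDFStat {Ω : Type*} [MeasurableSpace Ω] (P : Measure Ω) [IsProbabilityMeasure P]
    (X : Ω → Data n q) (σ : ℝ) (ω : Ω) (t : ℝ) : ℝ :=
  cdf (condDistrib (fun ω' => testStat C V σ (X ω')) (fun ω' => condVar C V (X ω')) P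
    (condVar C V (X ω))) t

/-- The selective p-value. -/
def pValue {Ω : Type*} [MeasurableSpace Ω] (P : Measure Ω) [IsProbabilityMeasure P]
    (X : Ω → Data n q) (σ : ℝ) (ω : Ω) : ℝ :=
  1 - condCDFStat C V P X σ ω (testStat C V σ (X ω))

end Procedure

/-- The chi-squared distribution with `d` degrees of freedom: the law of the sum of the squares of
`d` independent standard normal variables. -/
def chiSquared (d : ℕ) : Measure ℝ :=
  (Measure.pi fun _ : Fin d => gaussianReal 0 1).map fun z => ∑ i, z i ^ 2

/-- The law of `√Y` for `Y` chi-squared with `d` degrees of freedom. -/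
def chi (d : ℕ) : Measure ℝ := (chiSquared d).map Real.sqrt

/-- The CDF of the chi distribution truncated to `S` (meaningful when `chi d S ≠ 0`). -/
def truncChiCDF (d : ℕ) (S : Set ℝ) (t : ℝ) : ℝ :=
  (chi d).real (Set.Iic t ∩ S) / (chi d).real S

end KMeansTest

end

/-! Fix one outcome `(c, v)`. On the event that it occurs, the random space 𝓔 is a deterministic
space `E`, spanned by the contrasts of `v`. The null hypothesis says exactly that `P_E μ = 0`, so
`P_E X` is `σ` times the projection of a standard Gaussian matrix. By rotation invariance, `T = ‖P_E
X‖_F / σ` has law `chi d` and is independent of `R`, the pair of the direction of `P_E X` and the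
orthogonal part (`exists_map_stat_direction_perp`).

The data are recovered from `(T, R)`, so the outcome event has the form `(T, R) ∈ G`
(`mem_outcomeSet_iff`), and the truncation set is the section of `G` at `R` (`truncSet_eq`). On the
event the conditioning variable is `(c, v, R)`. Since the joint law is a product, Fubini identifies
the conditional law of `T` as `chi d` restricted to that section and normalized
(`ae_smul_condDistrib_eq_restrict`, `ae_cdf_condDistrib_eq`).

For uniformity, `chi d` has no atoms because `d > 0`. The probability integral transform in each
section yields `α` times the mass of the section (`measure_inter_one_sub_truncated_cdf_le`), and
integrating over `R` yields `α` times the probability of the event. There are finitely many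
outcomes, so the almost sure statements combine. Of the clustering algorithm, only measurability and
the finiteness of its range matter. -/

noncomputable section

namespace KMeansTest

/-! ### Polar decomposition of the standard Gaussian -/

section StdGaussian

variable {E : Type*} [NormedAddCommGroup E] [InnerProductSpace ℝ E] [FiniteDimensional ℝ E]
  [MeasurableSpace E] [BorelSpace E]

/-- The standard Gaussian density as a function of the norm, in dimension `d`. -/
def radialDensity (d : ℕ) (r : ℝ) : ENNReal :=
  ENNReal.ofReal (((2 * Real.pi) ^ ((d : ℝ) / 2))⁻¹ * Real.exp (-(1 / 2) * r ^ 2))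

lemma measurable_radialDensity (d : ℕ) : Measurable (radialDensity d) := by
  unfold radialDensity
  fun_prop

/-- Both sides have characteristic function `exp (-‖t‖² / 2)`, by the Gaussian Fourier integral. The
density form gives access to polar coordinates. -/
lemma stdGaussian_eq_withDensity :
    stdGaussian E =
      (volume : Measure E).withDensity fun x => radialDensity (Module.finrank ℝ E) ‖x‖ := by
  set d := Module.finrank ℝ E with hd
  have hZ : (0 : ℝ) < (2 * Real.pi) ^ ((d : ℝ) / 2) := by positivity
  have hint : Integrable (fun x : E => ((2 * Real.pi) ^ ((d : ℝ) / 2))⁻¹ *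
      Real.exp (-(1 / 2) * ‖x‖ ^ 2)) volume := by
    refine Integrable.const_mul ?_ _
    have h := (GaussianFourier.integrable_cexp_neg_mul_sq_norm_add (b := (1 / 2 : ℝ)) (V := E)
      (by norm_num) 0 0).norm
    refine h.congr (Filter.Eventually.of_forall fun x => ?_)
    simp only [Complex.norm_exp]
    congr 1
    simp [← Complex.ofReal_pow]
  have : IsFiniteMeasure
      ((volume : Measure E).withDensity fun x => radialDensity (Module.finrank ℝ E) ‖x‖) :=
    isFiniteMeasure_withDensity_ofReal hint.2
  refine Measure.ext_of_charFun (funext fun t => ?_)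
  rw [charFun_stdGaussian, charFun_apply, integral_withDensity_eq_integral_toReal_smul
    (f := fun x : E => radialDensity d ‖x‖) ((measurable_radialDensity _).comp measurable_norm)
    (Filter.Eventually.of_forall fun x => ENNReal.ofReal_lt_top)]
  have key := GaussianFourier.integral_cexp_neg_mul_sq_norm_add (b := (1 / 2 : ℝ)) (V := E)
      (by norm_num) Complex.I t
  have hfun : (fun x : E => (radialDensity (Module.finrank ℝ E) ‖x‖).toReal •
      Complex.exp ((inner ℝ x t : ℝ) * Complex.I)) = fun x : E =>
      (((2 * Real.pi) ^ ((d : ℝ) / 2))⁻¹ : ℝ) *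
        Complex.exp (-((1 / 2 : ℝ) : ℂ) * (‖x‖ : ℂ) ^ 2 + Complex.I * (inner ℝ t x : ℝ)) := by
    funext x
    rw [radialDensity, ENNReal.toReal_ofReal (by positivity), Complex.exp_add,
      real_inner_comm, Complex.real_smul, mul_comm Complex.I]
    push_cast
    ring
  rw [hfun, integral_const_mul, key, ← hd, ← mul_assoc]
  have h1 : ((((2 * Real.pi) ^ ((d : ℝ) / 2))⁻¹ : ℝ) : ℂ) *
      ((Real.pi : ℂ) / ((1 / 2 : ℝ) : ℂ)) ^ ((d : ℂ) / 2) = 1 := by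
    have : (Real.pi : ℂ) / ((1 / 2 : ℝ) : ℂ) = ((2 * Real.pi : ℝ) : ℂ) := by
      push_cast; ring
    rw [this, show ((d : ℂ) / 2) = (((d : ℝ) / 2 : ℝ) : ℂ) by push_cast; rfl,
      ← Complex.ofReal_cpow (by positivity), ← Complex.ofReal_mul, inv_mul_cancel₀ hZ.ne',
      Complex.ofReal_one]
  rw [h1, one_mul]
  congr 1
  simp only [Complex.I_sq]
  push_cast
  ring

/-- Polar coordinates; the origin, where the direction is undefined, is a null set. -/
lemma lintegral_norm_mul_direction [Nontrivial E] {g : ℝ → ENNReal} {h : E → ENNReal}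
    (hg : Measurable g) (hh : Measurable h) :
    ∫⁻ x : E, g ‖x‖ * h (‖x‖⁻¹ • x) =
      (∫⁻ s, h s ∂(volume : Measure E).toSphere) *
        ∫⁻ r, g r ∂(Measure.volumeIoiPow (Module.finrank ℝ E - 1)) := by
  have hmp := (volume : Measure E).measurePreserving_homeomorphUnitSphereProd
  rw [← lintegral_prod_mul (f := fun s : Metric.sphere (0 : E) 1 => h s)
    (g := fun r : Set.Ioi (0 : ℝ) => g r) (hh.comp measurable_subtype_coe).aemeasurable
    (hg.comp measurable_subtype_coe).aemeasurable,
    ← hmp.lintegral_comp_emb (Homeomorph.measurableEmbedding _)]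
  have h0 : MeasurableSet ({0}ᶜ : Set E) := (measurableSet_singleton 0).compl
  calc ∫⁻ x : E, g ‖x‖ * h (‖x‖⁻¹ • x)
      = ∫⁻ x in ({0}ᶜ : Set E), g ‖x‖ * h (‖x‖⁻¹ • x) := by
        rw [Measure.restrict_eq_self_of_ae_mem]
        exact compl_mem_ae_iff.2 (by simp)
    _ = _ := by
        rw [← lintegral_subtype_comap h0]
        refine lintegral_congr fun x => ?_
        simp [mul_comm]

lemma stdGaussian_norm_direction_apply [Nontrivial E] {B : Set ℝ} {D : Set E}
    (hB : MeasurableSet B) (hD : MeasurableSet D) :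
    stdGaussian E ((fun x => ‖x‖) ⁻¹' B ∩ (fun x => ‖x‖⁻¹ • x) ⁻¹' D) =
      (volume : Measure E).toSphere (Subtype.val ⁻¹' D) *
        ∫⁻ r, B.indicator (radialDensity (Module.finrank ℝ E)) r
          ∂(Measure.volumeIoiPow (Module.finrank ℝ E - 1)) := by
  have hmB : MeasurableSet ((fun x : E => ‖x‖) ⁻¹' B) := measurable_norm hB
  have hmD : MeasurableSet ((fun x : E => ‖x‖⁻¹ • x) ⁻¹' D) :=
    (measurable_norm.inv.smul measurable_id) hD
  rw [stdGaussian_eq_withDensity, withDensity_apply _ (hmB.inter hmD),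
    ← lintegral_indicator (hmB.inter hmD)]
  have := lintegral_norm_mul_direction (E := E)
    ((measurable_radialDensity (Module.finrank ℝ E)).indicator hB)
    ((measurable_const (a := (1 : ENNReal))).indicator hD)
  rw [← lintegral_indicator_one (measurable_subtype_coe hD)]
  refine Eq.trans (lintegral_congr fun x => ?_) this
  by_cases h1 : ‖x‖ ∈ B <;> by_cases h2 : ‖x‖⁻¹ • x ∈ D <;>
    simp [Set.indicator, h1, h2]

/-- The density depends only on the norm, so joint probabilities are a spherical factor times a
radial one. Neither factor is normalized, but the product of their total masses is 1, which is all
that independence needs. -/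
lemma indepFun_norm_direction_stdGaussian [Nontrivial E] :
    IndepFun (fun x : E => ‖x‖) (fun x : E => ‖x‖⁻¹ • x) (stdGaussian E) := by
  rw [indepFun_iff_measure_inter_preimage_eq_mul]
  intro B D hB hD
  have h := stdGaussian_norm_direction_apply (E := E) hB hD
  have hb := stdGaussian_norm_direction_apply (E := E) hB MeasurableSet.univ
  have hd := stdGaussian_norm_direction_apply (E := E) MeasurableSet.univ hD
  have hu := stdGaussian_norm_direction_apply (E := E) MeasurableSet.univ MeasurableSet.univ
  simp only [Set.preimage_univ, Set.inter_univ, Set.univ_inter, measure_univ] at hb hd hu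
  rw [h, hb, hd]
  rw [mul_mul_mul_comm, mul_comm ((volume : Measure E).toSphere Set.univ), mul_assoc,
    mul_left_comm _ ((volume : Measure E).toSphere Set.univ), ← mul_assoc,
    mul_comm (lintegral _ _) (lintegral _ _)]
  rw [mul_mul_mul_comm, ← hu, one_mul]

lemma map_norm_stdGaussian :
    (stdGaussian E).map (fun x => ‖x‖) = chi (Module.finrank ℝ E) := by
  rw [chi, chiSquared, stdGaussian, Measure.map_map (by fun_prop) (by fun_prop),
    Measure.map_map (by fun_prop) (by fun_prop)]
  congr 1
  funext x
  have := (stdOrthonormalBasis ℝ E).sum_sq_norm_inner_right (∑ i, x i • stdOrthonormalBasis ℝ E i)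
  simp only [Function.comp_apply]
  rw [← Real.sqrt_sq (norm_nonneg _), ← this]
  congr 1
  refine Finset.sum_congr rfl fun i _ => ?_
  rw [(stdOrthonormalBasis ℝ E).orthonormal.inner_right_fintype, Real.norm_eq_abs, sq_abs]

/-- The decomposition into `F` and `Fᗮ` is an isometry onto the L2 product, where the Gaussian
characteristic function factors by Pythagoras. -/
lemma map_orthogonalProjection_stdGaussian (F : Submodule ℝ E) :
    (stdGaussian E).map (fun x => (F.orthogonalProjectionOnto x, Fᗮ.orthogonalProjectionOnto x)) =
      (stdGaussian F).prod (stdGaussian Fᗮ) := by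
  rw [← charFun_eq_prod_iff]
  intro t
  rw [Measure.map_map (by fun_prop) (by fun_prop)]
  have : (WithLp.toLp 2 ∘ fun x => (F.orthogonalProjectionOnto x, Fᗮ.orthogonalProjectionOnto x)) =
      ⇑F.orthogonalDecomposition := by
    funext x
    simp
  rw [this, stdGaussian_map, charFun_stdGaussian, charFun_stdGaussian, charFun_stdGaussian,
    ← Complex.exp_add, ← Complex.ofReal_pow, WithLp.prod_norm_sq_eq_of_L2]
  congr 1
  push_cast
  ring_nf
  rfl

lemma chi_isProbabilityMeasure (d : ℕ) : IsProbabilityMeasure (chi d) := by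
  unfold chi chiSquared
  have : IsProbabilityMeasure ((Measure.pi fun _ : Fin d => gaussianReal 0 1).map
      fun z => ∑ i, z i ^ 2) :=
    Measure.isProbabilityMeasure_map (Measurable.aemeasurable (by fun_prop))
  exact Measure.isProbabilityMeasure_map (by fun_prop)

/-- For a standard Gaussian vector, the norm of the projection onto a subspace `F` has a chi
distribution and is independent of the direction of the projection and of the orthogonal part. -/
lemma map_norm_direction_orthogonal_stdGaussian (F : Submodule ℝ E) [Nontrivial F] :
    (stdGaussian E).map (fun x => (‖F.orthogonalProjectionOnto x‖,
      (‖F.orthogonalProjectionOnto x‖⁻¹ • F.orthogonalProjectionOnto x,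
        Fᗮ.orthogonalProjectionOnto x))) =
      (chi (Module.finrank ℝ F)).prod
        (((stdGaussian F).map fun x => ‖x‖⁻¹ • x).prod (stdGaussian Fᗮ)) := by
  have := chi_isProbabilityMeasure (Module.finrank ℝ F)
  have hm : Measurable fun x : F => ‖x‖⁻¹ • x := by fun_prop
  have : IsProbabilityMeasure ((stdGaussian F).map fun x => ‖x‖⁻¹ • x) :=
    Measure.isProbabilityMeasure_map hm.aemeasurable
  have hpolar : (stdGaussian F).map (fun x => (‖x‖, ‖x‖⁻¹ • x)) =
      (chi (Module.finrank ℝ F)).prod ((stdGaussian F).map fun x => ‖x‖⁻¹ • x) := by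
    have h := (indepFun_iff_map_prod_eq_prod_map_map (μ := stdGaussian F)
      measurable_norm.aemeasurable hm.aemeasurable).1 indepFun_norm_direction_stdGaussian
    rwa [map_norm_stdGaussian] at h
  have hfun : (fun x : E => (‖F.orthogonalProjectionOnto x‖,
      (‖F.orthogonalProjectionOnto x‖⁻¹ • F.orthogonalProjectionOnto x,
        Fᗮ.orthogonalProjectionOnto x))) =
      MeasurableEquiv.prodAssoc ∘ Prod.map (fun x : F => (‖x‖, ‖x‖⁻¹ • x)) id ∘
        fun x => (F.orthogonalProjectionOnto x, Fᗮ.orthogonalProjectionOnto x) := rfl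
  rw [hfun, ← Measure.map_map (by fun_prop) (by fun_prop),
    ← Measure.map_map (by fun_prop) (by fun_prop), map_orthogonalProjection_stdGaussian,
    ← Measure.map_prod_map _ _ (by fun_prop) (by fun_prop), hpolar, Measure.map_id,
    Measure.prodAssoc_prod]

end StdGaussian

/-- The norm takes a given value on a sphere, which is Lebesgue null. For `d = 0` the law is a point
mass at 0. -/
lemma chi_nullSingletonClass {d : ℕ} (hd : 0 < d) : NullSingletonClass (chi d) := by
  have : Nonempty (Fin d) := ⟨⟨0, hd⟩⟩
  refine ⟨fun r => ?_⟩
  have h := map_norm_stdGaussian (E := EuclideanSpace ℝ (Fin d))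
  rw [finrank_euclideanSpace_fin] at h
  rw [← h, Measure.map_apply measurable_norm (measurableSet_singleton r),
    stdGaussian_eq_withDensity]
  refine withDensity_absolutelyContinuous _ _ ?_
  have : (fun x : EuclideanSpace ℝ (Fin d) => ‖x‖) ⁻¹' {r} = Metric.sphere 0 r := by
    ext; simp
  rw [this]
  exact Measure.addHaar_sphere _ _ _

variable {n q K J : ℕ}

/-! ### Projections of data matrices and the null hypothesis -/

section Geometry

/-- The space of data matrices with the Frobenius inner product. -/
abbrev DataL2 (n q : ℕ) : Type := PiLp 2 fun _ : Fin n => EuclideanSpace ℝ (Fin q)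

/-- The `j`-th column of a data matrix. -/
def col (j : Fin q) : DataL2 n q →ₗ[ℝ] EuclideanSpace ℝ (Fin n) where
  toFun A := WithLp.toLp 2 fun i => A i j
  map_add' A B := by ext i; simp
  map_smul' a A := by ext i; simp

@[simp] lemma col_apply (j : Fin q) (A : DataL2 n q) (i : Fin n) : col j A i = A i j := rfl

lemma inner_eq_sum_inner_col (A B : DataL2 n q) :
    inner ℝ A B = ∑ j, inner ℝ (col j A) (col j B) := by
  simp only [PiLp.inner_apply, col_apply]
  exact Finset.sum_comm

/-- The data matrices with all columns in `E`. -/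
def columnSubmodule (q : ℕ) (E : Submodule ℝ (EuclideanSpace ℝ (Fin n))) :
    Submodule ℝ (DataL2 n q) :=
  ⨅ j, E.comap (col j)

lemma mem_columnSubmodule {E : Submodule ℝ (EuclideanSpace ℝ (Fin n))} {A : DataL2 n q} :
    A ∈ columnSubmodule q E ↔ ∀ j, col j A ∈ E := by
  simp [columnSubmodule]

/-- A matrix with columns in `E` is a tuple of elements of `E`. -/
def columnSubmoduleEquiv (q : ℕ) (E : Submodule ℝ (EuclideanSpace ℝ (Fin n))) :
    columnSubmodule q E ≃ₗ[ℝ] (Fin q → E) where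
  toFun A j := ⟨col j A, mem_columnSubmodule.1 A.2 j⟩
  map_add' A B := by ext; simp
  map_smul' a A := by ext; simp
  invFun f := ⟨WithLp.toLp 2 fun i => WithLp.toLp 2 fun j => (f j : EuclideanSpace ℝ (Fin n)) i,
    mem_columnSubmodule.2 fun j => (f j).2⟩
  left_inv A := rfl
  right_inv f := rfl

lemma finrank_columnSubmodule (q : ℕ) (E : Submodule ℝ (EuclideanSpace ℝ (Fin n))) :
    Module.finrank ℝ (columnSubmodule q E) = q * Module.finrank ℝ E := by
  rw [(columnSubmoduleEquiv q E).finrank_eq, Module.finrank_pi_fintype]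
  simp

lemma matMul_projMatrix_apply (E : Submodule ℝ (EuclideanSpace ℝ (Fin n))) (A : Data n q)
    (i : Fin n) (j : Fin q) :
    matMul (projMatrix E) A i j = E.starProjection (col j (WithLp.toLp 2 A)) i := by
  have h : col j (WithLp.toLp 2 A) = ∑ k, A k j • EuclideanSpace.single k (1 : ℝ) := by
    ext i
    simp [Finset.sum_apply, Pi.single_apply]
  rw [h, map_sum]
  simp [matMul, projMatrix, mul_comm]

/-- The Frobenius inner product is the sum of the inner products of the columns, so projecting every
column onto `E` leaves a residual orthogonal to all matrices with columns in `E`. -/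
lemma starProjection_columnSubmodule (E : Submodule ℝ (EuclideanSpace ℝ (Fin n))) (A : Data n q) :
    (columnSubmodule q E).starProjection (WithLp.toLp 2 A) =
      WithLp.toLp 2 (matMul (projMatrix E) A) := by
  have hcol : ∀ j, col j (WithLp.toLp 2 (matMul (projMatrix E) A)) =
      E.starProjection (col j (WithLp.toLp 2 A)) := by
    intro j
    ext i
    exact matMul_projMatrix_apply E A i j
  refine Submodule.eq_starProjection_of_mem_orthogonal (K := columnSubmodule q E) ?_ ?_
  · rw [mem_columnSubmodule]
    intro j
    rw [hcol]
    exact Submodule.starProjection_apply_mem _ _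
  · rw [Submodule.mem_orthogonal]
    intro B hB
    rw [inner_eq_sum_inner_col]
    refine Finset.sum_eq_zero fun j _ => ?_
    rw [map_sub, hcol]
    exact Submodule.inner_right_of_mem_orthogonal (mem_columnSubmodule.1 hB j)
      (Submodule.sub_starProjection_mem_orthogonal _)

lemma matMul_one_sub (M : Matrix (Fin n) (Fin n) ℝ) (A : Data n q) :
    matMul (1 - M) A = A - matMul M A := by
  funext i
  simp [matMul, sub_smul, Finset.sum_sub_distrib, Matrix.one_apply]

lemma matMul_add (M : Matrix (Fin n) (Fin n) ℝ) (A B : Data n q) :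
    matMul M (A + B) = matMul M A + matMul M B := by
  funext i
  simp [matMul, Finset.sum_add_distrib]

lemma matMul_smul (M : Matrix (Fin n) (Fin n) ℝ) (a : ℝ) (A : Data n q) :
    matMul M (a • A) = a • matMul M A := by
  funext i
  simp [matMul, Finset.smul_sum, smul_comm a]

lemma measurable_matMul (M : Matrix (Fin n) (Fin n) ℝ) :
    Measurable (matMul M : Data n q → Data n q) := by
  unfold matMul
  fun_prop

lemma frobNorm_eq_norm (A : Data n q) : frobNorm A = ‖(WithLp.toLp 2 A : DataL2 n q)‖ := by
  rw [PiLp.norm_eq_of_L2, frobNorm]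

lemma measurable_frobNorm : Measurable (frobNorm : Data n q → ℝ) := by
  unfold frobNorm
  fun_prop

lemma inner_contrast (c : Fin n → Fin K) (k k' : Fin K) (A : Data n q) (j : Fin q) :
    inner ℝ (contrast c k k') (col j (WithLp.toLp 2 A)) =
      clusterMean A c k j - clusterMean A c k' j := by
  have h : ∀ l : Fin K, clusterMean A c l j =
      ∑ i, A i j * if c i = l then ((cluster c l).card : ℝ)⁻¹ else 0 := by
    intro l
    simp only [clusterMean, cluster, Finset.sum_filter, PiLp.smul_apply, WithLp.ofLp_sum,
      Finset.sum_apply, smul_eq_mul, Finset.mul_sum]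
    refine Finset.sum_congr rfl fun i _ => ?_
    split_ifs <;> simp [mul_comm]
  rw [h, h, ← Finset.sum_sub_distrib]
  simp [PiLp.inner_apply, contrast, mul_sub]

/-- Pairing a contrast with a column of `μ` gives a difference of cluster means; under the null
every column is therefore orthogonal to the span. -/
lemma matMul_projMatrix_eq_zero_of_null {μ : Data n q} {c : Fin n → Fin K}
    {v : Finset (Fin K × Fin K)} (h : Null μ c v) :
    matMul (projMatrix (contrastSpan c v)) μ = 0 := by
  funext i
  ext j
  rw [matMul_projMatrix_apply]
  have : col j (WithLp.toLp 2 μ) ∈ (contrastSpan c v)ᗮ := by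
    rw [contrastSpan, Submodule.mem_orthogonal]
    intro u hu
    induction hu using Submodule.span_induction with
    | mem x hx =>
      obtain ⟨p, hp, rfl⟩ := hx
      rw [inner_contrast, h p hp, sub_self]
    | zero => simp
    | add x y _ _ hx hy => rw [inner_add_left, hx, hy, add_zero]
    | smul a x _ hx => rw [inner_smul_left, hx, mul_zero]
  rw [(Submodule.starProjection_apply_eq_zero_iff _).2 this]
  simp

/-- At an index of the first cluster the contrast equals the inverse cluster size: the second term
vanishes there since the two labels differ. -/
lemma contrastSpan_ne_bot {c : Fin n → Fin K} {v : Finset (Fin K × Fin K)} (h : Testable c v)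
    (hv : ∀ p ∈ v, p.1 < p.2) : contrastSpan c v ≠ ⊥ := by
  obtain ⟨p, hp⟩ := h.1
  obtain ⟨i, hi⟩ := (h.2 p hp).1
  have hi' : c i = p.1 := by simpa [cluster] using hi
  intro hbot
  have hmem : contrast c p.1 p.2 ∈ contrastSpan c v := Submodule.subset_span ⟨p, hp, rfl⟩
  rw [hbot, Submodule.mem_bot] at hmem
  have := congrArg (fun w : EuclideanSpace ℝ (Fin n) => w i) hmem
  have hcard : (cluster c p.1).card ≠ 0 := Finset.card_ne_zero_of_mem hi
  simp [contrast, hi', (hv p hp).ne, -Finset.card_eq_zero, hcard] at this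

end Geometry

/-! ### Law of the statistic for a fixed space -/

section Law

lemma multivariateGaussian_sq_smul_one (m : EuclideanSpace ℝ (Fin q)) {σ : ℝ} (hσ : 0 < σ) :
    multivariateGaussian m (σ ^ 2 • (1 : Matrix (Fin q) (Fin q) ℝ)) =
      (stdGaussian (EuclideanSpace ℝ (Fin q))).map fun x => m + σ • x := by
  open scoped MatrixOrder in
  have h : CFC.sqrt (σ ^ 2 • (1 : Matrix (Fin q) (Fin q) ℝ)) = σ • 1 := by
    refine CFC.sqrt_unique ?_ ?_
    · rw [smul_mul_smul_comm, mul_one, sq]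
    · exact (Matrix.PosSemidef.one.smul hσ.le).nonneg
  rw [multivariateGaussian, h]
  simp

variable {Ω : Type*} [MeasurableSpace Ω] {P : Measure Ω} [IsProbabilityMeasure P]

lemma map_standardize_eq_stdGaussian {σ : ℝ} (hσ : 0 < σ) {μ : Data n q} {X : Ω → Data n q}
    (hX : Measurable X) (hindep : iIndepFun (fun (i : Fin n) (ω : Ω) => X ω i) P)
    (hlaw : ∀ i : Fin n, P.map (fun ω => X ω i) =
      multivariateGaussian (μ i) (σ ^ 2 • (1 : Matrix (Fin q) (Fin q) ℝ))) :
    P.map (fun ω => (WithLp.toLp 2 (σ⁻¹ • (X ω - μ)) : DataL2 n q)) =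
      stdGaussian (DataL2 n q) := by
  have hXi : ∀ i, Measurable fun ω => X ω i := fun i => (measurable_pi_apply i).comp hX
  let g : Fin n → EuclideanSpace ℝ (Fin q) → EuclideanSpace ℝ (Fin q) :=
    fun i x => σ⁻¹ • (x - μ i)
  have hg : ∀ i, Measurable (g i) := fun i => by simp only [g]; fun_prop
  have hrow : ∀ i, P.map (fun ω => g i (X ω i)) = stdGaussian (EuclideanSpace ℝ (Fin q)) := by
    intro i
    have : P.map (fun ω => g i (X ω i)) = (P.map (fun ω => X ω i)).map (g i) :=
      (Measure.map_map (hg i) (hXi i)).symm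
    rw [this, hlaw, multivariateGaussian_sq_smul_one _ hσ, Measure.map_map (hg i) (by fun_prop)]
    have : (g i ∘ fun x => μ i + σ • x) = id := by
      funext x
      simp [g, smul_smul, inv_mul_cancel₀ hσ.ne']
    rw [this, Measure.map_id]
  have hpi : P.map (fun ω i => g i (X ω i)) =
      Measure.pi fun _ : Fin n => stdGaussian (EuclideanSpace ℝ (Fin q)) := by
    rw [(iIndepFun_iff_map_fun_eq_pi_map (f := fun i ω => g i (X ω i))
      fun i => ((hg i).comp (hXi i)).aemeasurable).1 (hindep.comp g hg)]
    simp_rw [hrow]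
  have hm : Measurable fun ω i => g i (X ω i) :=
    measurable_pi_lambda _ fun i => (hg i).comp (hXi i)
  have : P.map (fun ω => (WithLp.toLp 2 (σ⁻¹ • (X ω - μ)) : DataL2 n q)) =
      (P.map (fun ω i => g i (X ω i))).map (WithLp.toLp 2) :=
    (Measure.map_map (by fun_prop) hm).symm
  rw [this, hpi]
  refine Measure.ext_of_charFun (funext fun t => ?_)
  rw [charFun_pi, charFun_stdGaussian]
  simp_rw [charFun_stdGaussian, ← Complex.exp_sum, ← Complex.ofReal_pow]
  rw [PiLp.norm_sq_eq_of_L2]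
  simp [Finset.sum_div, neg_div]

/-- Under the null hypothesis the test statistic for a fixed space `E` has a chi distribution
and is independent of the direction and of the orthogonal part. -/
lemma exists_map_stat_direction_perp {σ : ℝ} (hσ : 0 < σ) {μ : Data n q} {X : Ω → Data n q}
    (hX : Measurable X) (hindep : iIndepFun (fun (i : Fin n) (ω : Ω) => X ω i) P)
    (hlaw : ∀ i : Fin n, P.map (fun ω => X ω i) =
      multivariateGaussian (μ i) (σ ^ 2 • (1 : Matrix (Fin q) (Fin q) ℝ)))
    (E : Submodule ℝ (EuclideanSpace ℝ (Fin n))) (hE : 0 < q * Module.finrank ℝ E)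
    (hμ : matMul (projMatrix E) μ = 0) :
    ∃ ρ : Measure (Data n q × Data n q), IsProbabilityMeasure ρ ∧
      P.map (fun ω => (frobNorm (matMul (projMatrix E) (X ω)) / σ,
        ((frobNorm (matMul (projMatrix E) (X ω)))⁻¹ • matMul (projMatrix E) (X ω),
          matMul (1 - projMatrix E) (X ω)))) =
        (chi (q * Module.finrank ℝ E)).prod ρ := by
  set F := columnSubmodule q E
  have hF : Module.finrank ℝ F = q * Module.finrank ℝ E := finrank_columnSubmodule q E
  have : Nontrivial F := Module.finrank_pos_iff.1 (hF ▸ hE)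
  have := chi_isProbabilityMeasure (Module.finrank ℝ F)
  -- The direction is unaffected by the scale `σ` and, as `P_E μ = 0`, by the mean; the orthogonal
  -- part is an affine image of the orthogonal noise.
  let φ : F × Fᗮ → Data n q × Data n q := fun p =>
    (WithLp.ofLp (p.1 : DataL2 n q), matMul (1 - projMatrix E) μ + σ • WithLp.ofLp (p.2 : DataL2 n q))
  have hφ : Measurable φ := by simp only [φ]; fun_prop
  have hm : Measurable fun x : F => ‖x‖⁻¹ • x := by fun_prop
  have : IsProbabilityMeasure ((stdGaussian F).map fun x => ‖x‖⁻¹ • x) :=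
    Measure.isProbabilityMeasure_map hm.aemeasurable
  refine ⟨(((stdGaussian F).map fun x => ‖x‖⁻¹ • x).prod (stdGaussian Fᗮ)).map φ,
    Measure.isProbabilityMeasure_map hφ.aemeasurable, ?_⟩
  have hG := map_standardize_eq_stdGaussian hσ hX hindep hlaw
  have hfun : (fun ω => (frobNorm (matMul (projMatrix E) (X ω)) / σ,
        ((frobNorm (matMul (projMatrix E) (X ω)))⁻¹ • matMul (projMatrix E) (X ω),
          matMul (1 - projMatrix E) (X ω)))) =
      Prod.map id φ ∘ (fun x : DataL2 n q => (‖F.orthogonalProjectionOnto x‖,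
        (‖F.orthogonalProjectionOnto x‖⁻¹ • F.orthogonalProjectionOnto x,
          Fᗮ.orthogonalProjectionOnto x))) ∘
        fun ω => (WithLp.toLp 2 (σ⁻¹ • (X ω - μ)) : DataL2 n q) := by
    funext ω
    have hXω : X ω = μ + σ • (σ⁻¹ • (X ω - μ)) := by
      rw [smul_smul, mul_inv_cancel₀ hσ.ne', one_smul, add_sub_cancel]
    generalize hA : σ⁻¹ • (X ω - μ) = A at hXω
    have hp : ((F.orthogonalProjectionOnto (WithLp.toLp 2 A) : F) : DataL2 n q) =
        WithLp.toLp 2 (matMul (projMatrix E) A) := starProjection_columnSubmodule E A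
    have hperp : ((Fᗮ.orthogonalProjectionOnto (WithLp.toLp 2 A) : Fᗮ) : DataL2 n q) =
        WithLp.toLp 2 (matMul (1 - projMatrix E) A) := by
      have := F.starProjection_orthogonal_val (WithLp.toLp 2 A)
      rw [starProjection_columnSubmodule, ← WithLp.toLp_sub, ← matMul_one_sub] at this
      exact this
    have h1 : matMul (projMatrix E) (X ω) = σ • matMul (projMatrix E) A := by
      rw [hXω, matMul_add, matMul_smul, hμ, zero_add]
    have h2 : matMul (1 - projMatrix E) (X ω) =
        matMul (1 - projMatrix E) μ + σ • matMul (1 - projMatrix E) A := by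
      rw [hXω, matMul_add, matMul_smul]
    have h3 : frobNorm (matMul (projMatrix E) (X ω)) =
        σ * ‖F.orthogonalProjectionOnto (WithLp.toLp 2 A)‖ := by
      rw [h1, frobNorm_eq_norm, WithLp.toLp_smul, norm_smul, Real.norm_of_nonneg hσ.le, ← hp]
      rfl
    simp only [Function.comp_apply, Prod.map_apply, id_eq, φ, hA]
    rw [h3, h2, h1, hperp, Submodule.coe_smul, hp, mul_div_cancel_left₀ _ hσ.ne', smul_smul,
      mul_inv_rev, mul_assoc, inv_mul_cancel₀ hσ.ne', mul_one]
    rfl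
  rw [hfun, ← Measure.map_map (measurable_id.prodMap hφ) (by fun_prop),
    ← Measure.map_map (by fun_prop) (by fun_prop), hG,
    map_norm_direction_orthogonal_stdGaussian, ← Measure.map_prod_map _ _ measurable_id hφ,
    Measure.map_id, ← hF]

end Law

/-! ### Probability integral transform for atomless laws -/

section IntegralTransform

lemma continuous_cdf_of_nullSingletonClass (ν : Measure ℝ) [IsProbabilityMeasure ν]
    [NullSingletonClass ν] : Continuous (cdf ν) := by
  rw [continuous_iff_continuousAt]
  intro x
  rw [(monotone_cdf ν).continuousAt_iff_leftLim_eq_rightLim, StieltjesFunction.rightLim_eq]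
  have h : (cdf ν).measure {x} = 0 := by rw [measure_cdf]; exact measure_singleton x
  rw [StieltjesFunction.measure_singleton, ENNReal.ofReal_eq_zero] at h
  exact le_antisymm ((monotone_cdf ν).leftLim_le le_rfl) (by linarith)

/-- For `β > 0`, if the CDF reaches `β`, the set is the open ray below the first such point `a`, and
continuity forces the value `β` at `a`. -/
lemma measure_cdf_lt (ν : Measure ℝ) [IsProbabilityMeasure ν] [NullSingletonClass ν] {β : ℝ}
    (h0 : 0 ≤ β) (h1 : β ≤ 1) : ν {t | cdf ν t < β} = ENNReal.ofReal β := by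
  have hc := continuous_cdf_of_nullSingletonClass ν
  rcases h0.eq_or_lt with rfl | hpos
  · have : {t | cdf ν t < 0} = ∅ := by
      ext t
      simpa using cdf_nonneg ν t
    simp [this]
  by_cases hne : {t | β ≤ cdf ν t}.Nonempty
  · obtain ⟨s, hs⟩ := ((tendsto_cdf_atBot ν).eventually (gt_mem_nhds hpos)).exists
    obtain ⟨u, hu⟩ := hne
    have hbdd : BddBelow {t | β ≤ cdf ν t} :=
      ⟨s, fun t ht => (lt_of_not_ge fun hle =>
        absurd (monotone_cdf ν hle) (not_le.2 (hs.trans_le ht))).le⟩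
    have hclosed : IsClosed {t | β ≤ cdf ν t} := isClosed_le continuous_const hc
    set a := sInf {t | β ≤ cdf ν t}
    have ha : β ≤ cdf ν a := hclosed.csInf_mem ⟨u, hu⟩ hbdd
    have hset : {t | cdf ν t < β} = Set.Iio a := by
      ext t
      constructor
      · intro ht
        exact lt_of_not_ge fun hle => absurd (monotone_cdf ν hle) (not_le.2 (lt_of_lt_of_le ht ha))
      · intro ht
        have hnot : t ∉ {t | β ≤ cdf ν t} := fun hle => absurd (csInf_le hbdd hle) (not_le.2 ht)
        exact lt_of_not_ge (fun h : β ≤ cdf ν t => hnot h)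
    -- The intermediate value theorem gives a point of value exactly `β`; minimality of `a` then
    -- bounds the CDF at `a` by `β`.
    obtain ⟨w, hw⟩ := mem_range_of_exists_le_of_exists_ge hc ⟨s, hs.le⟩ ⟨u, hu⟩
    have haw : a ≤ w := csInf_le hbdd hw.ge
    have hval : cdf ν a = β := le_antisymm ((monotone_cdf ν haw).trans hw.le) ha
    rw [hset, measure_congr Iio_ae_eq_Iic, ← ofReal_cdf, hval]
  · rw [Set.not_nonempty_iff_eq_empty] at hne
    have hall : ∀ t, cdf ν t < β := fun t => by
      by_contra h
      exact (Set.eq_empty_iff_forall_notMem.1 hne t) (not_lt.1 h)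
    -- A CDF that stays below `β` still tends to 1.
    have hβ : β = 1 := le_antisymm h1
      (le_of_tendsto (tendsto_cdf_atTop ν) (Filter.Eventually.of_forall fun t => (hall t).le))
    have : {t | cdf ν t < β} = Set.univ := by
      ext t
      simpa using hall t
    rw [this, measure_univ, hβ, ENNReal.ofReal_one]

lemma measure_one_sub_cdf_le (ν : Measure ℝ) [IsProbabilityMeasure ν] [NullSingletonClass ν]
    {α : ℝ} (h0 : 0 ≤ α) (h1 : α ≤ 1) : ν {t | 1 - cdf ν t ≤ α} = ENNReal.ofReal α := by
  have hset : {t | 1 - cdf ν t ≤ α} = {t | cdf ν t < 1 - α}ᶜ := by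
    ext t
    simp only [Set.mem_ofPred_eq, Set.mem_compl_iff, not_lt]
    constructor <;> intro h <;> linarith
  have hm : MeasurableSet {t | cdf ν t < 1 - α} :=
    measurableSet_lt (monotone_cdf ν).measurable measurable_const
  rw [hset, prob_compl_eq_one_sub hm, measure_cdf_lt ν (by linarith) (by linarith),
    ← ENNReal.ofReal_one, ← ENNReal.ofReal_sub _ (by linarith)]
  congr 1
  ring

/-- The probability integral transform for the restriction of a measure to a set. -/
lemma measure_inter_one_sub_truncated_cdf_le (m : Measure ℝ) [IsProbabilityMeasure m]
    [NullSingletonClass m] {S : Set ℝ} (hS : MeasurableSet S) {α : ℝ} (h0 : 0 ≤ α) (h1 : α ≤ 1) :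
    m (S ∩ {t | 1 - m.real (Set.Iic t ∩ S) / m.real S ≤ α}) = ENNReal.ofReal α * m S := by
  by_cases hmS : m S = 0
  · rw [hmS, mul_zero]
    exact measure_mono_null Set.inter_subset_left hmS
  have : IsProbabilityMeasure (ProbabilityTheory.cond m S) := cond_isProbabilityMeasure hmS
  have : NullSingletonClass (ProbabilityTheory.cond m S) :=
    ⟨fun x => cond_absolutelyContinuous (measure_singleton x)⟩
  have hcdf : ∀ t, cdf (ProbabilityTheory.cond m S) t = m.real (Set.Iic t ∩ S) / m.real S := by
    intro t
    rw [cdf_eq_real, measureReal_def, cond_apply hS, Set.inter_comm, div_eq_inv_mul,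
      ENNReal.toReal_mul, ENNReal.toReal_inv, measureReal_def, measureReal_def]
  have h := measure_one_sub_cdf_le (ProbabilityTheory.cond m S) h0 h1
  simp_rw [hcdf] at h
  rw [cond_apply hS] at h
  rw [← h, mul_comm, ← mul_assoc, ENNReal.mul_inv_cancel hmS (measure_ne_top _ _), one_mul]

end IntegralTransform

/-! ### Conditional law on an event determined by independent variables -/

section ConditionalLaw

variable {Ω β γ : Type*} [MeasurableSpace Ω] [MeasurableSpace β] [MeasurableSpace γ]
  {P : Measure Ω} {m : Measure ℝ} [IsProbabilityMeasure m]
  {ρ : Measure β} [IsProbabilityMeasure ρ] {T T' : Ω → ℝ} {R : Ω → β} {Y : Ω → γ}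
  {G : Set (ℝ × β)} {e : β → γ} {g : γ → β} {D : Set γ}

lemma measurable_measure_section (hG : MeasurableSet G) :
    Measurable fun r => m {t | (t, r) ∈ G} :=
  measurable_measure_prodMk_right hG

lemma measure_preimage_of_map_eq_prod (hT : Measurable T) (hR : Measurable R)
    (hTR : P.map (fun ω => (T ω, R ω)) = m.prod ρ) {N : Set (ℝ × β)} (hN : MeasurableSet N) :
    P {ω | (T ω, R ω) ∈ N} = ∫⁻ r, m {t | (t, r) ∈ N} ∂ρ := by
  have h := Measure.map_apply (μ := P) (hT.prodMk hR) hN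
  rw [hTR, Measure.prod_apply_symm hN] at h
  exact h.symm

lemma map_eq_of_map_eq_prod (hT : Measurable T) (hR : Measurable R)
    (hTR : P.map (fun ω => (T ω, R ω)) = m.prod ρ) : P.map R = ρ := by
  have h := Measure.map_map (μ := P) measurable_snd (hT.prodMk hR)
  rw [hTR, Measure.map_snd_prod, measure_univ, one_smul] at h
  exact h.symm

/-- If `T` has law `m` and is independent of `R`, then the conditional law of `T` given `R` on the
event that `(T, R)` lies in `G` is `m` restricted to the section of `G` and normalized; here the
conditioning variable `Y` carries the information of `R` on that event, and reveals the event. -/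
lemma ae_smul_condDistrib_eq_restrict [IsProbabilityMeasure P] (hT : Measurable T) (hR : Measurable R)
    (hT' : Measurable T') (hY : Measurable Y)
    (hTR : P.map (fun ω => (T ω, R ω)) = m.prod ρ) (hG : MeasurableSet G)
    (he : Measurable e) (hg : Measurable g) (hge : ∀ r, g (e r) = r) (hD : MeasurableSet D)
    (hDG : ∀ ω, Y ω ∈ D ↔ (T ω, R ω) ∈ G) (hYe : ∀ ω, Y ω ∈ D → Y ω = e (R ω))
    (hTT : ∀ ω, Y ω ∈ D → T' ω = T ω) :
    ∀ᵐ r ∂ρ, m {t | (t, r) ∈ G} • condDistrib T' Y P (e r) = m.restrict {t | (t, r) ∈ G} := by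
  have hsec : ∀ r, MeasurableSet {t | (t, r) ∈ G} := fun r => measurable_prodMk_right hG
  have hmS : Measurable fun r => m {t | (t, r) ∈ G} := measurable_measure_section hG
  -- For fixed `I`, the two functions of `r` are compared through their integrals over arbitrary
  -- sets `B`. Keeping the section's mass as a factor avoids division where it vanishes.
  have key : ∀ I : Set ℝ, MeasurableSet I → ∀ᵐ r ∂ρ,
      m {t | (t, r) ∈ G} * condDistrib T' Y P (e r) I = m {t | (t, r) ∈ G ∩ Prod.fst ⁻¹' I} := by
    intro I hI
    have hcd : Measurable fun r => condDistrib T' Y P (e r) I :=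
      (Kernel.measurable_coe _ hI).comp he
    have hGI : MeasurableSet (G ∩ Prod.fst ⁻¹' I) := hG.inter (measurable_fst hI)
    refine ae_eq_of_forall_setLIntegral_eq_of_sigmaFinite (hmS.mul hcd)
      (measurable_measure_prodMk_right hGI) fun B hB _ => ?_
    have hGB : MeasurableSet (G ∩ Prod.snd ⁻¹' B) := hG.inter (measurable_snd hB)
    have hYB : Y ⁻¹' (D ∩ g ⁻¹' B) = {ω | (T ω, R ω) ∈ G ∩ Prod.snd ⁻¹' B} := by
      ext ω
      simp only [Set.mem_preimage, Set.mem_inter_iff, Set.mem_ofPred_eq, ← hDG]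
      refine and_congr_right fun h => ?_
      rw [hYe ω h, hge]
    have hYm : MeasurableSet (Y ⁻¹' (D ∩ g ⁻¹' B)) := hY (hD.inter (hg hB))
    have h1 := setLIntegral_preimage_condDistrib (μ := P) hY hT'.aemeasurable hI
      (hD.inter (hg hB))
    -- On the event the integrand depends on `R` alone, so integrating out `T` produces the mass of
    -- the section.
    have h2 : ∫⁻ ω in Y ⁻¹' (D ∩ g ⁻¹' B), condDistrib T' Y P (Y ω) I ∂P =
        ∫⁻ r in B, m {t | (t, r) ∈ G} * condDistrib T' Y P (e r) I ∂ρ := by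
      let f : ℝ × β → ENNReal := (G ∩ Prod.snd ⁻¹' B).indicator
        fun p => condDistrib T' Y P (e p.2) I
      have hf : Measurable f := (hcd.comp measurable_snd).indicator hGB
      calc ∫⁻ ω in Y ⁻¹' (D ∩ g ⁻¹' B), condDistrib T' Y P (Y ω) I ∂P
          = ∫⁻ ω, f (T ω, R ω) ∂P := by
            rw [← lintegral_indicator hYm]
            refine lintegral_congr fun ω => ?_
            by_cases hω : ω ∈ Y ⁻¹' (D ∩ g ⁻¹' B)
            · have hω' := hω
              rw [hYB] at hω'
              rw [Set.indicator_of_mem hω, hYe ω hω.1]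
              have hp : (T ω, R ω) ∈ G ∩ Prod.snd ⁻¹' B := hω'
              simp only [f, Set.indicator_of_mem hp]
            · have hω' := hω
              rw [hYB] at hω'
              rw [Set.indicator_of_notMem hω]
              have hp : (T ω, R ω) ∉ G ∩ Prod.snd ⁻¹' B := hω'
              simp only [f, Set.indicator_of_notMem hp]
        _ = ∫⁻ p, f p ∂(m.prod ρ) := by
            rw [← hTR, lintegral_map hf (hT.prodMk hR)]
        _ = ∫⁻ r, ∫⁻ t, f (t, r) ∂m ∂ρ := lintegral_prod_symm f hf.aemeasurable
        _ = _ := by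
            rw [← lintegral_indicator hB]
            refine lintegral_congr fun r => ?_
            by_cases hr : r ∈ B
            · rw [Set.indicator_of_mem hr, mul_comm, ← lintegral_indicator_const (hsec r)]
              refine lintegral_congr fun t => ?_
              by_cases ht : (t, r) ∈ G <;> simp [f, Set.indicator, ht, hr]
            · simp [f, Set.indicator, hr]
    have h3 : Y ⁻¹' (D ∩ g ⁻¹' B) ∩ T' ⁻¹' I =
        {ω | (T ω, R ω) ∈ (G ∩ Prod.fst ⁻¹' I) ∩ Prod.snd ⁻¹' B} := by
      ext ω
      have hb : ω ∈ Y ⁻¹' (D ∩ g ⁻¹' B) ↔ (T ω, R ω) ∈ G ∩ Prod.snd ⁻¹' B := by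
        rw [hYB]
        rfl
      rw [Set.mem_inter_iff, hb]
      simp only [Set.mem_inter_iff, Set.mem_preimage, Set.mem_ofPred_eq]
      constructor
      · rintro ⟨⟨h, hr⟩, hi⟩
        exact ⟨⟨h, hTT ω ((hDG ω).2 h) ▸ hi⟩, hr⟩
      · rintro ⟨⟨h, hi⟩, hr⟩
        exact ⟨⟨h, hr⟩, (hTT ω ((hDG ω).2 h)).symm ▸ hi⟩
    rw [← h2, h1, h3, measure_preimage_of_map_eq_prod hT hR hTR (hGI.inter (measurable_snd hB)),
      ← lintegral_indicator hB]
    refine lintegral_congr fun r => ?_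
    by_cases hr : r ∈ B <;> simp [hr]
  -- Countably many rational intervals allow one common null set and still determine a finite
  -- measure on the line.
  have hall : ∀ᵐ r ∂ρ, ∀ a b : ℚ, m {t | (t, r) ∈ G} * condDistrib T' Y P (e r) (Set.Ioo a b) =
      m {t | (t, r) ∈ G ∩ Prod.fst ⁻¹' (Set.Ioo (a : ℝ) b)} :=
    ae_all_iff.2 fun a => ae_all_iff.2 fun b => key _ measurableSet_Ioo
  filter_upwards [hall] with r hr
  have := Measure.smul_finite (condDistrib T' Y P (e r)) (measure_ne_top m {t | (t, r) ∈ G})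
  refine Real.measure_ext_Ioo_rat fun a b => ?_
  rw [Measure.smul_apply, smul_eq_mul, hr a b, Measure.restrict_apply measurableSet_Ioo,
    Set.inter_comm]
  rfl

/-- By Fubini, almost surely `(T, R)` does not lie in `G` over a section of mass zero, so on the
event the unnormalized identity can be divided by that mass. -/
lemma ae_cdf_condDistrib_eq [IsProbabilityMeasure P] (hT : Measurable T) (hR : Measurable R)
    (hT' : Measurable T') (hY : Measurable Y)
    (hTR : P.map (fun ω => (T ω, R ω)) = m.prod ρ) (hG : MeasurableSet G)
    (he : Measurable e) (hg : Measurable g) (hge : ∀ r, g (e r) = r) (hD : MeasurableSet D)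
    (hDG : ∀ ω, Y ω ∈ D ↔ (T ω, R ω) ∈ G) (hYe : ∀ ω, Y ω ∈ D → Y ω = e (R ω))
    (hTT : ∀ ω, Y ω ∈ D → T' ω = T ω) :
    ∀ᵐ ω ∂P, Y ω ∈ D → m {t | (t, R ω) ∈ G} ≠ 0 ∧
      ∀ t, cdf (condDistrib T' Y P (Y ω)) t =
        m.real (Set.Iic t ∩ {t | (t, R ω) ∈ G}) / m.real {t | (t, R ω) ∈ G} := by
  have hmap := map_eq_of_map_eq_prod hT hR hTR
  have hmS : Measurable fun r => m {t | (t, r) ∈ G} := measurable_measure_section hG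
  have h1 := ae_smul_condDistrib_eq_restrict hT hR hT' hY hTR hG he hg hge hD hDG hYe hTT
  rw [← hmap] at h1
  have h1' := ae_of_ae_map hR.aemeasurable h1
  have h2 : ∀ᵐ ω ∂P, Y ω ∈ D → m {t | (t, R ω) ∈ G} ≠ 0 := by
    have hz : MeasurableSet {r | m {t | (t, r) ∈ G} = 0} := hmS (measurableSet_singleton 0)
    have h0 : P {ω | (T ω, R ω) ∈ G ∩ Prod.snd ⁻¹' {r | m {t | (t, r) ∈ G} = 0}} = 0 := by
      rw [measure_preimage_of_map_eq_prod hT hR hTR (hG.inter (measurable_snd hz)),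
        lintegral_eq_zero_iff (measurable_measure_section (hG.inter (measurable_snd hz)))]
      refine Filter.Eventually.of_forall fun r => ?_
      by_cases hr : m {t | (t, r) ∈ G} = 0
      · exact measure_mono_null (fun t ht => ht.1) hr
      · simp [hr]
    filter_upwards [measure_eq_zero_iff_ae_notMem.1 h0] with ω hω hY0 hm
    exact hω ⟨(hDG ω).1 hY0, hm⟩
  filter_upwards [h1', h2] with ω hω hne hYD
  refine ⟨hne hYD, fun t => ?_⟩
  have hreal : m.real {t | (t, R ω) ∈ G} ≠ 0 := by
    rw [measureReal_def, ENNReal.toReal_ne_zero]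
    exact ⟨hne hYD, measure_ne_top _ _⟩
  rw [cdf_eq_real, hYe ω hYD, eq_div_iff hreal, mul_comm]
  have := congrArg (fun ν : Measure ℝ => (ν (Set.Iic t)).toReal) hω
  simpa [Measure.restrict_apply measurableSet_Iic, measureReal_def] using this

lemma measure_one_sub_cdf_condDistrib_le [IsProbabilityMeasure P] [NullSingletonClass m]
    (hT : Measurable T) (hR : Measurable R)
    (hT' : Measurable T') (hY : Measurable Y)
    (hTR : P.map (fun ω => (T ω, R ω)) = m.prod ρ) (hG : MeasurableSet G)
    (he : Measurable e) (hg : Measurable g) (hge : ∀ r, g (e r) = r) (hD : MeasurableSet D)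
    (hDG : ∀ ω, Y ω ∈ D ↔ (T ω, R ω) ∈ G) (hYe : ∀ ω, Y ω ∈ D → Y ω = e (R ω))
    (hTT : ∀ ω, Y ω ∈ D → T' ω = T ω) {α : ℝ} (h0 : 0 ≤ α) (h1 : α ≤ 1) :
    P (Y ⁻¹' D ∩ {ω | 1 - cdf (condDistrib T' Y P (Y ω)) (T' ω) ≤ α}) =
      ENNReal.ofReal α * P (Y ⁻¹' D) := by
  have hae := ae_cdf_condDistrib_eq hT hR hT' hY hTR hG he hg hge hD hDG hYe hTT
  -- The p-value event with the conditional CDF replaced by the truncated one, a jointly measurable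
  -- set in `(T, R)` to which Fubini applies.
  let N : Set (ℝ × β) := {p | 1 - m.real (Set.Iic p.1 ∩ {t | (t, p.2) ∈ G}) /
    m.real {t | (t, p.2) ∈ G} ≤ α}
  have hN : MeasurableSet N := by
    have hm1 : Measurable fun p : ℝ × β => m.real (Set.Iic p.1 ∩ {t | (t, p.2) ∈ G}) := by
      have hset : MeasurableSet {x : (ℝ × β) × ℝ | x.2 ≤ x.1.1 ∧ (x.2, x.1.2) ∈ G} :=
        (measurableSet_le measurable_snd (measurable_fst.comp measurable_fst)).inter
          ((measurable_snd.prodMk (measurable_snd.comp measurable_fst)) hG)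
      exact (measurable_measure_prodMk_left hset).ennreal_toReal
    have hm2 : Measurable fun p : ℝ × β => m.real {t | (t, p.2) ∈ G} :=
      ((measurable_measure_prodMk_right (μ := m) hG).comp measurable_snd).ennreal_toReal
    exact measurableSet_le (measurable_const.sub (hm1.div hm2)) measurable_const
  have hYG : Y ⁻¹' D = {ω | (T ω, R ω) ∈ G} := Set.ext hDG
  have hcongr : P (Y ⁻¹' D ∩ {ω | 1 - cdf (condDistrib T' Y P (Y ω)) (T' ω) ≤ α}) =
      P {ω | (T ω, R ω) ∈ G ∩ N} := by
    refine measure_congr ?_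
    filter_upwards [hae] with ω hω
    refine propext ?_
    change (Y ω ∈ D ∧ 1 - cdf (condDistrib T' Y P (Y ω)) (T' ω) ≤ α) ↔
      ((T ω, R ω) ∈ G ∧ 1 - m.real (Set.Iic (T ω) ∩ {t | (t, R ω) ∈ G}) /
        m.real {t | (t, R ω) ∈ G} ≤ α)
    rw [← hDG]
    refine and_congr_right fun h => ?_
    rw [(hω h).2, hTT ω h]
  rw [hcongr, hYG, measure_preimage_of_map_eq_prod hT hR hTR (hG.inter hN),
    measure_preimage_of_map_eq_prod hT hR hTR hG,
    ← lintegral_const_mul _ (measurable_measure_section hG)]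
  exact lintegral_congr fun r =>
    measure_inter_one_sub_truncated_cdf_le m (measurable_prodMk_right hG) h0 h1

end ConditionalLaw

/-! ### Measurability of the clustering and of the statistics -/

section Measurability

/-- Reduces a data-dependent assignment or projection space to fixed ones, since these are indexed
by a countable type. -/
lemma measurable_uncurry_comp_of_countable {ι α δ : Type*} [MeasurableSpace ι] [Countable ι]
    [MeasurableSingletonClass ι] [MeasurableSpace α] [MeasurableSpace δ] {f : ι → α → δ}
    (hf : ∀ i, Measurable (f i)) {k : α → ι} (hk : Measurable k) :
    Measurable fun a => f (k a) a :=
  (measurable_from_prod_countable_right (f := fun p : ι × α => f p.1 p.2) hf).comp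
    (hk.prodMk measurable_id)

lemma measurable_nearest {α : Type*} [MeasurableSpace α] {x : α → EuclideanSpace ℝ (Fin q)}
    (hx : Measurable x) (L : Finset (Fin K)) {m : α → Fin K → EuclideanSpace ℝ (Fin q)}
    (hm : Measurable m) : Measurable fun a => nearest (x a) L (m a) := by
  refine measurable_finset_iff.2 fun l => ?_
  have hml : ∀ l, Measurable fun a => m a l := fun l => (measurable_pi_apply l).comp hm
  simp only [nearest, Finset.mem_filter]
  refine Measurable.and measurable_const (Measurable.forall fun l' => Measurable.imp
    measurable_const ?_)
  exact measurableSet_setOfPred.1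
    (measurableSet_le ((hx.sub (hml l)).norm) ((hx.sub (hml l')).norm))

lemma measurable_clusterMean (c : Fin n → Fin K) :
    Measurable fun A : Data n q => clusterMean A c := by
  unfold clusterMean
  fun_prop

lemma measurable_lloyd (tie : Finset (Fin K) → Fin K)
    {init : Data n q → Fin K → EuclideanSpace ℝ (Fin q)} (hinit : Measurable init) (j : ℕ) :
    Measurable fun A => lloyd tie init A j := by
  induction j with
  | zero =>
    refine measurable_pi_lambda _ fun i => ?_
    exact (measurable_of_countable tie).comp
      (measurable_nearest (measurable_pi_apply i) Finset.univ hinit)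
  | succ j ih =>
    refine measurable_pi_lambda _ fun i => ?_
    refine (measurable_of_countable tie).comp
      (measurable_uncurry_comp_of_countable (f := fun (c : Fin n → Fin K) (A : Data n q) =>
        nearest (A i) (Finset.univ.filter fun l => (cluster c l).Nonempty) (clusterMean A c))
        (fun c => ?_) ih)
    exact measurable_nearest (measurable_pi_apply i) _ (measurable_clusterMean c)

lemma measurable_kmeans (J : ℕ) (tie : Finset (Fin K) → Fin K)
    {init : Data n q → Fin K → EuclideanSpace ℝ (Fin q)} (hinit : Measurable init) :
    Measurable (kmeans J tie init) :=
  measurable_pi_lambda _ fun j => measurable_lloyd tie hinit j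

variable {C : Data n q → History n K J} {V : Data n q → Finset (Fin K × Fin K)}

lemma measurable_projPart (hC : Measurable C) (hV : Measurable V) : Measurable (projPart C V) := by
  have h := measurable_uncurry_comp_of_countable
    (f := fun (y : History n K J × Finset (Fin K × Fin K)) (A : Data n q) =>
      matMul (projMatrix (contrastSpan (finalAssign y.1) y.2)) A)
    (fun _ => measurable_matMul _) (k := fun A => (C A, V A)) (hC.prodMk hV)
  exact h

lemma measurable_perpPart (hC : Measurable C) (hV : Measurable V) : Measurable (perpPart C V) := by
  have h := measurable_uncurry_comp_of_countable
    (f := fun (y : History n K J × Finset (Fin K × Fin K)) (A : Data n q) =>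
      matMul (1 - projMatrix (contrastSpan (finalAssign y.1) y.2)) A)
    (fun _ => measurable_matMul _) (k := fun A => (C A, V A)) (hC.prodMk hV)
  exact h

lemma measurable_testStat (hC : Measurable C) (hV : Measurable V) (σ : ℝ) :
    Measurable (testStat C V σ) :=
  (measurable_frobNorm.comp (measurable_projPart hC hV)).div_const σ

lemma measurable_condVar (hC : Measurable C) (hV : Measurable V) : Measurable (condVar C V) := by
  refine hC.prodMk (hV.prodMk (Measurable.prodMk ?_ (measurable_perpPart hC hV)))
  exact (measurable_frobNorm.comp (measurable_projPart hC hV)).inv.smul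
    (measurable_projPart hC hV)

end Measurability

/-! ### Reduction to a fixed outcome -/

section Outcome

lemma frobNorm_smul_normalize (B : Data n q) : frobNorm B • ((frobNorm B)⁻¹ • B) = B := by
  rw [smul_smul]
  by_cases h : frobNorm B = 0
  · have hB : B = 0 := by
      rw [frobNorm_eq_norm, norm_eq_zero, WithLp.toLp_eq_zero] at h
      exact h
    simp [hB]
  · rw [mul_inv_cancel₀ h, one_smul]

variable (C : Data n q → History n K J) (V : Data n q → Finset (Fin K × Fin K)) (σ : ℝ)
  (c : History n K J) (v : Finset (Fin K × Fin K))

/-- The statistic and the direction and orthogonal part for which the clustering outcome is `c`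
and the selection is `v`. -/
def outcomeSet : Set (ℝ × (Data n q × Data n q)) :=
  {p | 0 ≤ p.1 ∧ C (p.1 • (σ • p.2.1) + p.2.2) = c ∧ V (p.1 • (σ • p.2.1) + p.2.2) = v}

/-- The test statistic for a fixed space `E`. -/
def fixedStat (E : Submodule ℝ (EuclideanSpace ℝ (Fin n))) (A : Data n q) : ℝ :=
  frobNorm (matMul (projMatrix E) A) / σ

/-- The direction and the orthogonal part for a fixed space `E`. -/
def fixedRest (E : Submodule ℝ (EuclideanSpace ℝ (Fin n))) (A : Data n q) :
    Data n q × Data n q :=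
  ((frobNorm (matMul (projMatrix E) A))⁻¹ • matMul (projMatrix E) A,
    matMul (1 - projMatrix E) A)

variable {C V σ c v}

lemma measurable_fixedStat (E : Submodule ℝ (EuclideanSpace ℝ (Fin n))) :
    Measurable (fixedStat σ E : Data n q → ℝ) :=
  (measurable_frobNorm.comp (measurable_matMul _)).div_const σ

lemma measurable_fixedRest (E : Submodule ℝ (EuclideanSpace ℝ (Fin n))) :
    Measurable (fixedRest E : Data n q → Data n q × Data n q) :=
  ((measurable_frobNorm.comp (measurable_matMul _)).inv.smul (measurable_matMul _)).prodMk
    (measurable_matMul _)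

lemma measurableSet_outcomeSet (hC : Measurable C) (hV : Measurable V) :
    MeasurableSet (outcomeSet C V σ c v) := by
  have hm : Measurable fun p : ℝ × (Data n q × Data n q) => p.1 • (σ • p.2.1) + p.2.2 := by
    fun_prop
  exact (measurableSet_le measurable_const measurable_fst).inter
    (((hC.comp hm) (measurableSet_singleton c)).inter ((hV.comp hm) (measurableSet_singleton v)))

lemma fixedStat_smul_fixedRest (hσ : 0 < σ) (E : Submodule ℝ (EuclideanSpace ℝ (Fin n)))
    (A : Data n q) :
    fixedStat σ E A • (σ • (fixedRest E A).1) + (fixedRest E A).2 = A := by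
  simp only [fixedStat, fixedRest]
  rw [smul_smul, div_mul_cancel₀ _ hσ.ne', frobNorm_smul_normalize, matMul_one_sub,
    add_sub_cancel]

lemma mem_outcomeSet_iff (hσ : 0 < σ) (E : Submodule ℝ (EuclideanSpace ℝ (Fin n)))
    (A : Data n q) :
    (fixedStat σ E A, fixedRest E A) ∈ outcomeSet C V σ c v ↔ C A = c ∧ V A = v := by
  have h0 : 0 ≤ fixedStat σ E A := div_nonneg (Real.sqrt_nonneg _) hσ.le
  simp only [outcomeSet, Set.mem_ofPred_eq, fixedStat_smul_fixedRest hσ, h0, true_and]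

/-- On the outcome the curve through `A` uses the fixed space, so it depends on `A` only through the
direction and the orthogonal part. -/
lemma truncSet_eq {A : Data n q} (hc : C A = c) (hv : V A = v) :
    truncSet C V σ A =
      {t | (t, fixedRest (contrastSpan (finalAssign c) v) A) ∈ outcomeSet C V σ c v} := by
  subst hc hv
  ext t
  change ((0 ≤ t ∧ C A = C _) ∧ (0 ≤ t ∧ V A = V _)) ↔ (0 ≤ t ∧ C _ = C A ∧ V _ = V A)
  constructor
  · rintro ⟨⟨h0, h1⟩, -, h2⟩
    exact ⟨h0, h1.symm, h2.symm⟩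
  · rintro ⟨h0, h1, h2⟩
    exact ⟨⟨h0, h1.symm⟩, h0, h2.symm⟩

variable {Ω : Type*} [MeasurableSpace Ω] {P : Measure Ω} [IsProbabilityMeasure P]
  {μ : Data n q} {X : Ω → Data n q}

/-- Both claims for one outcome `(c, v)`. -/
lemma selective_inference_of_outcome (hq : 0 < q) (hσ : 0 < σ)
    (hX : Measurable X) (hindep : iIndepFun (fun (i : Fin n) (ω : Ω) => X ω i) P)
    (hlaw : ∀ i : Fin n, P.map (fun ω => X ω i) =
      multivariateGaussian (μ i) (σ ^ 2 • (1 : Matrix (Fin q) (Fin q) ℝ)))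
    (hC : Measurable C) (hV : Measurable V) (hv : ∀ p ∈ v, p.1 < p.2)
    (htest : Testable (finalAssign c) v) (hnull : Null μ (finalAssign c) v) :
    (∀ᵐ ω ∂P, C (X ω) = c ∧ V (X ω) = v →
      chi (q * Module.finrank ℝ (testSpace C V (X ω))) (truncSet C V σ (X ω)) ≠ 0 ∧
        ∀ t : ℝ, condCDFStat C V P X σ ω t =
          truncChiCDF (q * Module.finrank ℝ (testSpace C V (X ω))) (truncSet C V σ (X ω)) t) ∧
    ∀ α ∈ Set.Icc (0 : ℝ) 1,
      P ({ω | C (X ω) = c ∧ V (X ω) = v} ∩ {ω | pValue C V P X σ ω ≤ α}) =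
        ENNReal.ofReal α * P {ω | C (X ω) = c ∧ V (X ω) = v} := by
  set E := contrastSpan (finalAssign c) v with hEdef
  have hE : 0 < q * Module.finrank ℝ E := by
    refine Nat.mul_pos hq (Nat.pos_of_ne_zero fun h => ?_)
    exact contrastSpan_ne_bot htest hv (Submodule.finrank_eq_zero.1 h)
  obtain ⟨ρ, hρ, hTR⟩ := exists_map_stat_direction_perp hσ hX hindep hlaw E hE
    (matMul_projMatrix_eq_zero_of_null hnull)
  have := chi_isProbabilityMeasure (q * Module.finrank ℝ E)
  have := chi_nullSingletonClass hE
  have hT : Measurable fun ω => fixedStat σ E (X ω) := (measurable_fixedStat E).comp hX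
  have hR : Measurable fun ω => fixedRest E (X ω) := (measurable_fixedRest E).comp hX
  have hT' : Measurable fun ω => testStat C V σ (X ω) := (measurable_testStat hC hV σ).comp hX
  have hY : Measurable fun ω => condVar C V (X ω) := (measurable_condVar hC hV).comp hX
  have hG : MeasurableSet (outcomeSet C V σ c v) := measurableSet_outcomeSet hC hV
  -- The outcome event as seen by the conditioning variable; below, `e` inserts `(c, v)` and `g`
  -- forgets it.
  let D : Set (History n K J × Finset (Fin K × Fin K) × (Data n q × Data n q)) :=
    {y | y.1 = c ∧ y.2.1 = v}
  have hD : MeasurableSet D :=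
    (measurable_fst (measurableSet_singleton c)).inter
      ((measurable_fst.comp measurable_snd) (measurableSet_singleton v))
  have he : Measurable fun r : Data n q × Data n q => (c, v, r) := by fun_prop
  have hg : Measurable fun y : History n K J × Finset (Fin K × Fin K) × (Data n q × Data n q) =>
    y.2.2 := by fun_prop
  have hDG : ∀ ω, condVar C V (X ω) ∈ D ↔
      (fixedStat σ E (X ω), fixedRest E (X ω)) ∈ outcomeSet C V σ c v :=
    fun ω => (mem_outcomeSet_iff hσ E (X ω)).symm
  have hspace : ∀ ω, condVar C V (X ω) ∈ D → testSpace C V (X ω) = E := by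
    rintro ω ⟨h1, h2⟩
    change C (X ω) = c at h1
    change V (X ω) = v at h2
    rw [testSpace, h1, h2]
  have hYe : ∀ ω, condVar C V (X ω) ∈ D → condVar C V (X ω) = (c, v, fixedRest E (X ω)) := by
    intro ω h
    have hs := hspace ω h
    obtain ⟨h1, h2⟩ := h
    change C (X ω) = c at h1
    change V (X ω) = v at h2
    simp only [condVar, direction, projPart, perpPart, hs, h1, h2, fixedRest]
  have hTT : ∀ ω, condVar C V (X ω) ∈ D → testStat C V σ (X ω) = fixedStat σ E (X ω) := by
    intro ω h
    simp only [testStat, projPart, hspace ω h, fixedStat]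
  constructor
  · filter_upwards [ae_cdf_condDistrib_eq hT hR hT' hY hTR hG he hg (fun _ => rfl) hD hDG hYe hTT]
      with ω hω h
    rw [truncSet_eq h.1 h.2, hspace ω h]
    exact hω h
  · intro α hα
    exact measure_one_sub_cdf_condDistrib_le hT hR hT' hY hTR hG he hg (fun _ => rfl) hD hDG hYe
      hTT hα.1 hα.2

end Outcome

end KMeansTest

end

theorem mainTheorem1
    {n q K J : ℕ} (hq : 0 < q)
    {Ω : Type*} [MeasurableSpace Ω] (P : Measure Ω) [IsProbabilityMeasure P]
    (σ : ℝ) (hσ : 0 < σ) (μ : KMeansTest.Data n q)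
    (X : Ω → KMeansTest.Data n q) (hX : Measurable X)
    (hindep : iIndepFun (fun (i : Fin n) (ω : Ω) => X ω i) P)
    (hlaw : ∀ i : Fin n, P.map (fun ω => X ω i) =
      multivariateGaussian (μ i) (σ ^ 2 • (1 : Matrix (Fin q) (Fin q) ℝ)))
    (tie : Finset (Fin K) → Fin K) (htie : ∀ L : Finset (Fin K), L.Nonempty → tie L ∈ L)
    (init : KMeansTest.Data n q → Fin K → EuclideanSpace ℝ (Fin q)) (hinit : Measurable init)
    (C : KMeansTest.Data n q → KMeansTest.History n K J)
    (hC : C = KMeansTest.kmeans J tie init)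
    (V : KMeansTest.Data n q → Finset (Fin K × Fin K)) (hV : Measurable V)
    (hVall : ∀ A, ∀ p ∈ V A, p.1 < p.2) :
    (∀ᵐ ω ∂P,
      KMeansTest.Testable (KMeansTest.finalAssign (C (X ω))) (V (X ω)) →
      KMeansTest.Null μ (KMeansTest.finalAssign (C (X ω))) (V (X ω)) →
        KMeansTest.chi (q * Module.finrank ℝ (KMeansTest.testSpace C V (X ω)))
          (KMeansTest.truncSet C V σ (X ω)) ≠ 0 ∧
        ∀ t : ℝ, KMeansTest.condCDFStat C V P X σ ω t =
          KMeansTest.truncChiCDF (q * Module.finrank ℝ (KMeansTest.testSpace C V (X ω)))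
            (KMeansTest.truncSet C V σ (X ω)) t) ∧
    (∀ (c : KMeansTest.History n K J) (v : Finset (Fin K × Fin K)),
      P {ω | C (X ω) = c ∧ V (X ω) = v} ≠ 0 →
      KMeansTest.Testable (KMeansTest.finalAssign c) v →
      KMeansTest.Null μ (KMeansTest.finalAssign c) v →
        ∀ α ∈ Set.Icc (0 : ℝ) 1,
          ProbabilityTheory.cond P {ω | C (X ω) = c ∧ V (X ω) = v}
            {ω | KMeansTest.pValue C V P X σ ω ≤ α} = ENNReal.ofReal α) := by
  have hCm : Measurable C := hC ▸ KMeansTest.measurable_kmeans J tie hinit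
  have main : ∀ (c : KMeansTest.History n K J) (v : Finset (Fin K × Fin K)),
      (∀ p ∈ v, p.1 < p.2) → KMeansTest.Testable (KMeansTest.finalAssign c) v →
      KMeansTest.Null μ (KMeansTest.finalAssign c) v → _ := fun c v hv htest hnull =>
    KMeansTest.selective_inference_of_outcome (c := c) (v := v) hq hσ hX hindep hlaw hCm hV hv
      htest hnull
  constructor
  -- The outcomes form a countable type, so the exceptional null sets can be united before the
  -- random outcome is substituted.
  · have hall : ∀ᵐ ω ∂P, ∀ (c : KMeansTest.History n K J) (v : Finset (Fin K × Fin K)),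
        (∀ p ∈ v, p.1 < p.2) → KMeansTest.Testable (KMeansTest.finalAssign c) v →
        KMeansTest.Null μ (KMeansTest.finalAssign c) v → C (X ω) = c ∧ V (X ω) = v →
        KMeansTest.chi (q * Module.finrank ℝ (KMeansTest.testSpace C V (X ω)))
          (KMeansTest.truncSet C V σ (X ω)) ≠ 0 ∧
        ∀ t : ℝ, KMeansTest.condCDFStat C V P X σ ω t =
          KMeansTest.truncChiCDF (q * Module.finrank ℝ (KMeansTest.testSpace C V (X ω)))
            (KMeansTest.truncSet C V σ (X ω)) t := by
      simp only [ae_all_iff, Filter.eventually_imp_distrib_left]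
      intro c v hv htest hnull
      exact (main c v hv htest hnull).1
    filter_upwards [hall] with ω hω htest hnull
    exact hω _ _ (hVall _) htest hnull ⟨rfl, rfl⟩
  · intro c v hP htest hnull α hα
    -- Positive probability makes `v` an attained selection, hence a set of ordered pairs.
    have hne : {ω | C (X ω) = c ∧ V (X ω) = v}.Nonempty := nonempty_of_measure_ne_zero hP
    have hv : ∀ p ∈ v, p.1 < p.2 := by
      obtain ⟨ω, -, rfl⟩ := hne
      exact hVall _
    have hm : MeasurableSet {ω | C (X ω) = c ∧ V (X ω) = v} :=
      ((hCm.comp hX) (measurableSet_singleton c)).inter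
        ((hV.comp hX) (measurableSet_singleton v))
    rw [ProbabilityTheory.cond_apply hm, (main c v hv htest hnull).2 α hα, mul_left_comm,
      ENNReal.inv_mul_cancel hP (measure_ne_top _ _), mul_one]
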